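/- Let $d\ge 1$, let $\omega=e^{2\pi i/d}$, and read all indices modulo $d$. For $\alpha=(\alpha_{ij})\in\mathbb{C}^{d\times d}$ let $$K_i=\sum_{j,k=0}^{d-1}\alpha_{ij}\,\omega^{kj}\,|k+i\rangle\langle k|\quad(0\le i\le d-1),\qquad \mathcal{E}_\alpha(\rho)=\sum_{i=0}^{d-1}K_i\rho K_i^\dagger ,$$ so that $K_i=\sum_j\alpha_{ij}X_iZ_j$ is a linear combination of Heisenberg–Weyl operators $X_iZ_j=\sum_k\omega^{kj}|k+i\rangle\langle k|$. Let $\mathcal{C}(d)$ be the set of all linear maps on $\mathbb{C}^{d\times d}$ that have the form $\mathcal{E}_\alpha$ for some $\alpha$ and are both trace-preserving and unital. Then $\mathcal{C}(d)$, as a subset of the finite-dimensional space of linear maps on $\mathbb{C}^{d\times d}$, has real (Hausdorff) dimension $$\dim\mathcal{C}(d)=2d^2-3d+1 .$$ This agrees with the following count. Let $\mathcal{A}(d)$ be the set of $\alpha\in\mathbb{C}^{d\times d}$ with $\sum_{i,j}\alpha_{ij}\alpha_{ij}^*=1$ and, for $l=1,\dots,d-1$, $\sum_{i,j}\alpha_{i,j+l}\alpha_{ij}^*=0$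 and $\sum_{i,j}\alpha_{i,j+l}\alpha_{ij}^*\omega^{-il}=0$. Then $\mathcal{C}(d)=\{\mathcal{E}_\alpha:\alpha\in\mathcal{A}(d)\}$; two matrices $\alpha,\beta\in\mathbb{C}^{d\times d}$ satisfy $\mathcal{E}_\alpha=\mathcal{E}_\beta$ if and only if there are phases $u_0,\dots,u_{d-1}\in U(1)$ with $\beta_{ij}=u_i\alpha_{ij}$ for all $i,j$; the space $\mathbb{C}^{d\times d}$ has real dimension $2d^2$; $\dim\mathcal{A}(d)=2d^2-(2(d-1)+1)$; and $\dim U(1)^d=d$. -/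

import Mathlib

open scoped Matrix

noncomputable section

namespace HeisenbergWeyl

/-- The real dimension of a subset `S` of a finite-dimensional real vector space: the Hausdorff
dimension of `S` in linear coordinates. By `realDim_eq` it does not depend on the coordinates. -/
def realDim {V : Type*} [AddCommGroup V] [Module ℝ V] [FiniteDimensional ℝ V] (S : Set V) :
    ENNReal :=
  dimH ((Module.finBasis ℝ V).equivFun '' S)

theorem realDim_eq {V W : Type*} [AddCommGroup V] [Module ℝ V] [FiniteDimensional ℝ V]
    [NormedAddCommGroup W] [NormedSpace ℝ W] (e : V ≃ₗ[ℝ] W) (S : Set V) :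
    realDim S = dimH (e '' S) := by
  have : FiniteDimensional ℝ W := e.finiteDimensional
  have h := ((Module.finBasis ℝ V).equivFun.symm.trans e).toContinuousLinearEquiv.dimH_image
    ((Module.finBasis ℝ V).equivFun '' S)
  rw [realDim, ← h, ← Set.image_comp]
  congr 2
  ext x
  simp

/-- The primitive root of unity `ω = exp (2 π i / d)`. -/
def omega (d : ℕ) : ℂ := Complex.exp (2 * Real.pi * Complex.I / d)

/-- The Heisenberg–Weyl operator `X_i Z_j = ∑ₖ ω^{k j} |k + i⟩⟨k|`, indices modulo `d`. -/
def weyl (d : ℕ) [NeZero d] (i j : ZMod d) : Matrix (ZMod d) (ZMod d) ℂ :=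
  ∑ k : ZMod d, omega d ^ (k.val * j.val) • Matrix.single (k + i) k (1 : ℂ)

/-- The Kraus operator `K_i = ∑ⱼ α_{ij} X_i Z_j`. -/
def kraus {d : ℕ} [NeZero d] (α : Matrix (ZMod d) (ZMod d) ℂ) (i : ZMod d) :
    Matrix (ZMod d) (ZMod d) ℂ :=
  ∑ j : ZMod d, α i j • weyl d i j

/-- The linear map `ρ ↦ ∑ᵢ K_i ρ K_i†` with coefficient matrix `α`. -/
def krausMap {d : ℕ} [NeZero d] (α : Matrix (ZMod d) (ZMod d) ℂ) :
    Matrix (ZMod d) (ZMod d) ℂ →ₗ[ℂ] Matrix (ZMod d) (ZMod d) ℂ where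
  toFun ρ := ∑ i : ZMod d, kraus α i * ρ * (kraus α i)ᴴ
  map_add' ρ σ := by
    simp only [Matrix.mul_add, Matrix.add_mul, Finset.sum_add_distrib]
  map_smul' c ρ := by
    simp only [Matrix.mul_smul, Matrix.smul_mul, Finset.smul_sum, RingHom.id_apply]

/-- `Tr E(ρ) = Tr ρ`. -/
def IsTracePreserving {d : ℕ} [NeZero d]
    (E : Matrix (ZMod d) (ZMod d) ℂ →ₗ[ℂ] Matrix (ZMod d) (ZMod d) ℂ) : Prop :=
  ∀ ρ, (E ρ).trace = ρ.trace

/-- `E(1) = 1`. -/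
def IsUnital {d : ℕ} [NeZero d]
    (E : Matrix (ZMod d) (ZMod d) ℂ →ₗ[ℂ] Matrix (ZMod d) (ZMod d) ℂ) : Prop :=
  E 1 = 1

/-- The set of unital trace-preserving maps that have a Heisenberg–Weyl Kraus family. -/
def channels (d : ℕ) [NeZero d] :
    Set (Matrix (ZMod d) (ZMod d) ℂ →ₗ[ℂ] Matrix (ZMod d) (ZMod d) ℂ) :=
  {E | (∃ α, E = krausMap α) ∧ IsTracePreserving E ∧ IsUnital E}

/-- The set `𝒜(d)` of coefficient matrices cut out by the normalisation, trace-preservation and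
unitality equations. -/
def coefficients (d : ℕ) [NeZero d] : Set (Matrix (ZMod d) (ZMod d) ℂ) :=
  {α | (∑ i, ∑ j, α i j * star (α i j) = 1) ∧
    (∀ l : ZMod d, l ≠ 0 → ∑ i, ∑ j, α i (j + l) * star (α i j) = 0) ∧
    (∀ l : ZMod d, l ≠ 0 → ∑ i, ∑ j, α i (j + l) * star (α i j) *
      omega d ^ (-((i.val * l.val : ℕ) : ℤ)) = 0)}

end HeisenbergWeyl

end

/-! Each `K_i` is supported on the cyclic diagonal `m - k = i`, where its entries `a_{km}` are the
discrete Fourier transform of row `i` of `α`. So `α ↦ a` is a linear bijection. In these coordinates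
trace preservation and unitality say that the matrix `|a_{km}|²` has row and column sums `1`, and
the equations of `𝒜(d)` are the Fourier transforms of these conditions (`mem_coefficients_iff`).

Doubly stochastic squared moduli leave `(d - 1)²` real parameters, and each of the `d²` entries adds
one phase-like parameter, here its imaginary part. This gives `dim 𝒜(d)`. The map `E_α` records
exactly the products `a_{km} a_{ln}^*` along each diagonal (`gram`), hence each diagonal up to one
phase. Making row `0` real uses up these `d` phases, which leaves `(d - 1)² + (d - 1) d` parameters.

Upper bounds come from covering a set by finitely many `C¹` images of sets of parameters, lower
bounds from `C¹` maps onto open sets of parameters and from a `C¹` left inverse of `gram` on the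
normalised slice. -/

noncomputable section

namespace HeisenbergWeyl

/-! ### Hausdorff dimension under smooth and linear maps -/

section Dimension

/-- A map that is `C¹` at all points of a set does not increase the dimension of that set. -/
theorem dimH_image_le_of_contDiffAt {E F : Type*} [NormedAddCommGroup E] [NormedSpace ℝ E]
    [FiniteDimensional ℝ E] [NormedAddCommGroup F] [NormedSpace ℝ F] {f : E → F} {s : Set E}
    (hf : ∀ x ∈ s, ContDiffAt ℝ 1 f x) : dimH (f '' s) ≤ dimH s := by
  have := FiniteDimensional.proper ℝ E
  refine dimH_image_le_of_locally_lipschitzOn fun x hx => ?_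
  obtain ⟨K, t, ht, hK⟩ := (hf x hx).exists_lipschitzOnWith
  exact ⟨K, t, mem_nhdsWithin_of_mem_nhds ht, hK⟩

/-- An injective linear map does not change the real dimension of a set. -/
theorem realDim_eq_dimH_image {V W : Type*} [AddCommGroup V] [Module ℝ V] [FiniteDimensional ℝ V]
    [NormedAddCommGroup W] [NormedSpace ℝ W] (R : V →ₗ[ℝ] W)
    (hR : Function.Injective R) (S : Set V) : realDim S = dimH (R '' S) := by
  let φ := (Module.finBasis ℝ V).equivFun
  let T : (Fin (Module.finrank ℝ V) → ℝ) →ₗ[ℝ] W := R ∘ₗ φ.symm.toLinearMap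
  have hT : LinearMap.ker T = ⊥ :=
    LinearMap.ker_eq_bot.2 (hR.comp φ.symm.injective)
  have himage : R '' S = T '' (φ '' S) := by
    rw [← Set.image_comp]
    refine Set.image_congr fun x _ => ?_
    simp [T]
  obtain ⟨K, -, hK⟩ := T.exists_antilipschitzWith hT
  rw [realDim, himage]
  exact le_antisymm (hK.le_dimH_image _)
    ((LinearMap.toContinuousLinearMap T).lipschitz.dimH_image_le _)

end Dimension

/-! ### Matrices with doubly stochastic squared moduli -/

section Bistochastic

variable {ι : Type*} [DecidableEq ι]

/-- The extension by zero of a function on a set of matrix positions. -/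
def extendZero (T : Finset (ι × ι)) (y : T → ℝ) (k m : ι) : ℝ :=
  if h : (k, m) ∈ T then y ⟨(k, m), h⟩ else 0

theorem contDiff_extendZero (T : Finset (ι × ι)) (k m : ι) :
    ContDiff ℝ 1 fun y : T → ℝ => extendZero T y k m := by
  unfold extendZero
  split_ifs <;> fun_prop

variable [Fintype ι]

/-- The complex matrices whose squared moduli form a doubly stochastic matrix. -/
def bistochasticModuli (ι : Type*) [Fintype ι] : Set (ι → ι → ℂ) :=
  {a | (∀ k, ∑ m, Complex.normSq (a k m) = 1) ∧ ∀ m, ∑ k, Complex.normSq (a k m) = 1}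

/-- The matrix with row and column sums `1` and prescribed entries outside row and column `o`. -/
def completion (o : ι) (x : {k : ι // k ≠ o} → {m : ι // m ≠ o} → ℝ) (k m : ι) : ℝ :=
  if hk : k = o then
    if hm : m = o then 1 - ∑ m', (1 - ∑ k', x k' m') else 1 - ∑ k', x k' ⟨m, hm⟩
  else
    if hm : m = o then 1 - ∑ m', x ⟨k, hk⟩ m' else x ⟨k, hk⟩ ⟨m, hm⟩

theorem sum_completion_row (o : ι) (x : {k : ι // k ≠ o} → {m : ι // m ≠ o} → ℝ) (k : ι) :
    ∑ m, completion o x k m = 1 := by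
  rw [Fintype.sum_eq_add_sum_subtype_ne _ o]
  by_cases hk : k = o
  · simp [completion, hk, fun m : {m : ι // m ≠ o} => m.2]
  · simp [completion, hk, fun m : {m : ι // m ≠ o} => m.2]

theorem sum_completion_column (o : ι) (x : {k : ι // k ≠ o} → {m : ι // m ≠ o} → ℝ) (m : ι) :
    ∑ k, completion o x k m = 1 := by
  rw [Fintype.sum_eq_add_sum_subtype_ne _ o]
  by_cases hm : m = o
  -- The corner entry is defined through row `o`; exchanging the double sum shows that it also
  -- completes column `o`.
  · have := Finset.sum_comm (s := Finset.univ) (t := Finset.univ) (f := x)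
    simp [completion, hm, fun m : {m : ι // m ≠ o} => m.2, this]
  · simp [completion, hm, fun m : {m : ι // m ≠ o} => m.2]

theorem eq_completion (o : ι) {B : ι → ι → ℝ} (hrow : ∀ k, ∑ m, B k m = 1)
    (hcol : ∀ m, ∑ k, B k m = 1) :
    B = completion o fun k m => B k m := by
  have hr : ∀ k, B k o = 1 - ∑ m : {m : ι // m ≠ o}, B k m := fun k => by
    rw [← hrow k, Fintype.sum_eq_add_sum_subtype_ne _ o]; ring
  have hc : ∀ m, B o m = 1 - ∑ k : {k : ι // k ≠ o}, B k m := fun m => by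
    rw [← hcol m, Fintype.sum_eq_add_sum_subtype_ne _ o]; ring
  funext k m
  by_cases hk : k = o <;> by_cases hm : m = o
  · subst hk hm
    simp only [completion, dif_pos]
    rw [hr]
    simp_rw [← hc]
  · subst hk
    simp [completion, hm, ← hc]
  · subst hm
    simp [completion, hk, ← hr]
  · simp [completion, hk, hm]

theorem contDiff_completion (o k m : ι) :
    ContDiff ℝ 1 fun x : {k : ι // k ≠ o} → {m : ι // m ≠ o} → ℝ => completion o x k m := by
  unfold completion
  split_ifs <;> fun_prop

/-- The parameters of a matrix with doubly stochastic squared moduli: the squared moduli outside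
row and column `o`, and the imaginary parts at the positions in `T`. -/
abbrev Parameters (o : ι) (T : Finset (ι × ι)) : Type _ :=
  ({k : ι // k ≠ o} → {m : ι // m ≠ o} → ℝ) × (T → ℝ)

/-- The squared real part determined by the parameters. -/
def reSq (o : ι) (T : Finset (ι × ι)) (p : Parameters o T) (k m : ι) : ℝ :=
  completion o p.1 k m - extendZero T p.2 k m ^ 2

theorem contDiff_reSq (o : ι) (T : Finset (ι × ι)) (k m : ι) :
    ContDiff ℝ 1 fun p => reSq o T p k m :=
  ((contDiff_completion o k m).comp contDiff_fst).sub
    (((contDiff_extendZero T k m).comp contDiff_snd).pow 2)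

/-- The matrix with given parameters and given signs of the real parts. -/
def assemble (o : ι) (T : Finset (ι × ι)) (s : ι → ι → SignType) (p : Parameters o T)
    (k m : ι) : ℂ :=
  ((s k m : ℝ) * √(reSq o T p k m) : ℝ) + (extendZero T p.2 k m : ℝ) * Complex.I

/-- The square root is smooth only away from zero. Where the sign is `0` the real part vanishes
identically in the parameters, so no positivity is needed there. -/
theorem contDiffAt_assemble (o : ι) (T : Finset (ι × ι)) (s : ι → ι → SignType)
    (p : Parameters o T) (hp : ∀ k m, s k m ≠ 0 → 0 < reSq o T p k m) :
    ContDiffAt ℝ 1 (assemble o T s) p := by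
  refine contDiffAt_pi.2 fun k => contDiffAt_pi.2 fun m => ?_
  refine ContDiffAt.add ?_ ?_
  · refine Complex.ofRealCLM.contDiff.contDiffAt.comp p ?_
    change ContDiffAt ℝ 1 (fun q => (s k m : ℝ) * √(reSq o T q k m)) p
    by_cases h : s k m = 0
    · simp only [h, SignType.coe_zero, zero_mul]
      exact contDiffAt_const
    · exact contDiffAt_const.mul ((contDiff_reSq o T k m).contDiffAt.sqrt (hp k m h).ne')
  · exact (Complex.ofRealCLM.contDiff.contDiffAt.comp p
      ((contDiff_extendZero T k m).comp contDiff_snd).contDiffAt).mul contDiffAt_const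

/-- The parameters of a matrix. -/
def parameters (o : ι) (T : Finset (ι × ι)) (a : ι → ι → ℂ) : Parameters o T :=
  (fun k m => Complex.normSq (a k m), fun t => (a t.1.1 t.1.2).im)

theorem contDiff_parameters (o : ι) (T : Finset (ι × ι)) : ContDiff ℝ 1 (parameters o T) := by
  have hre : ContDiff ℝ 1 Complex.re := Complex.reCLM.contDiff
  have him : ContDiff ℝ 1 Complex.im := Complex.imCLM.contDiff
  unfold parameters
  simp only [Complex.normSq_apply]
  fun_prop

theorem reSq_parameters (o : ι) (T : Finset (ι × ι)) {a : ι → ι → ℂ}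
    (ha : a ∈ bistochasticModuli ι) (hT : ∀ k m, (k, m) ∉ T → (a k m).im = 0) (k m : ι) :
    reSq o T (parameters o T a) k m = (a k m).re ^ 2 ∧
      extendZero T (parameters o T a).2 k m = (a k m).im := by
  have h2 : extendZero T (parameters o T a).2 k m = (a k m).im := by
    by_cases h : (k, m) ∈ T
    · simp [extendZero, parameters, h]
    · simp [extendZero, h, hT k m h]
  refine ⟨?_, h2⟩
  have h1 := congrFun (congrFun (eq_completion o (B := fun k m => Complex.normSq (a k m))
    ha.1 ha.2) k) m
  rw [reSq, h2]
  change completion o (fun k m => Complex.normSq (a k m)) k m - _ = _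
  rw [← h1, Complex.normSq_apply]
  ring

theorem assemble_parameters (o : ι) (T : Finset (ι × ι)) {a : ι → ι → ℂ}
    (ha : a ∈ bistochasticModuli ι) (hT : ∀ k m, (k, m) ∉ T → (a k m).im = 0) :
    assemble o T (fun k m => SignType.sign (a k m).re) (parameters o T a) = a := by
  funext k m
  obtain ⟨h1, h2⟩ := reSq_parameters o T ha hT k m
  rw [assemble, h1, h2, Real.sqrt_sq_eq_abs, sign_mul_abs, Complex.re_add_im]

theorem finrank_parameters (o : ι) (T : Finset (ι × ι)) :
    Module.finrank ℝ (Parameters o T) = (Fintype.card ι - 1) ^ 2 + T.card := by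
  simp [Parameters, Module.finrank_pi_fintype, sq]

/-- The matrices with doubly stochastic squared moduli that are real outside the positions `T`
have dimension at most `(d - 1) ^ 2 + |T|`. -/
theorem dimH_bistochasticModuli_le (o : ι) (T : Finset (ι × ι)) :
    dimH {a ∈ bistochasticModuli ι | ∀ k m, (k, m) ∉ T → (a k m).im = 0} ≤
      ((Fintype.card ι - 1) ^ 2 + T.card : ℕ) := by
  -- There are finitely many patterns of signs in `{-1, 0, 1}`, and the pattern of the real parts
  -- together with the parameters determines the matrix.
  have hsub : {a ∈ bistochasticModuli ι | ∀ k m, (k, m) ∉ T → (a k m).im = 0} ⊆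
      ⋃ s : ι → ι → SignType,
        assemble o T s '' {p | ∀ k m, s k m ≠ 0 → 0 < reSq o T p k m} := by
    rintro a ⟨ha, hT⟩
    refine Set.mem_iUnion.2 ⟨fun k m => SignType.sign (a k m).re, parameters o T a,
      fun k m h => ?_, assemble_parameters o T ha hT⟩
    rw [(reSq_parameters o T ha hT k m).1]
    exact sq_pos_of_ne_zero (by simpa using h)
  refine (dimH_mono hsub).trans ?_
  rw [dimH_iUnion]
  refine iSup_le fun s => ?_
  refine (dimH_image_le_of_contDiffAt fun p hp => contDiffAt_assemble o T s p hp).trans ?_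
  refine (dimH_mono (Set.subset_univ _)).trans ?_
  rw [Real.dimH_univ_eq_finrank, finrank_parameters]

/-- The matrices with doubly stochastic squared moduli and positive real parts that are real
outside the positions `T` have dimension at least `(d - 1) ^ 2 + |T|`. -/
theorem le_dimH_bistochasticModuli (o : ι) (T : Finset (ι × ι)) :
    ((Fintype.card ι - 1) ^ 2 + T.card : ℕ) ≤
      dimH {a ∈ bistochasticModuli ι |
        (∀ k m, (k, m) ∉ T → (a k m).im = 0) ∧ ∀ k m, 0 < (a k m).re} := by
  let U : Set (Parameters o T) := {p | ∀ k m, 0 < reSq o T p k m}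
  have hU : IsOpen U := by
    simp only [U, Set.ofPred_forall]
    exact isOpen_iInter_of_finite fun k => isOpen_iInter_of_finite fun m =>
      isOpen_lt continuous_const (contDiff_reSq o T k m).continuous
  have hc : (0 : ℝ) < (Fintype.card ι : ℝ)⁻¹ :=
    inv_pos.2 (Nat.cast_pos.2 (Fintype.card_pos_iff.2 ⟨o⟩))
  -- The flat matrix with all squared moduli `1/d` and no imaginary parts shows that the open set is
  -- nonempty.
  have hne : (fun _ _ => (Fintype.card ι : ℝ)⁻¹, fun _ => 0) ∈ U := by
    have hsum : ∑ _k : ι, (Fintype.card ι : ℝ)⁻¹ = 1 := by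
      simp [mul_inv_cancel₀ (inv_pos.1 hc).ne']
    have h := eq_completion o (B := fun _ _ : ι => (Fintype.card ι : ℝ)⁻¹)
      (fun _ => hsum) (fun _ => hsum)
    intro k m
    have h' := congrFun (congrFun h k) m
    simp only [reSq, ← h']
    simpa [extendZero] using hc
  have hsub : U ⊆ parameters o T '' {a ∈ bistochasticModuli ι |
      (∀ k m, (k, m) ∉ T → (a k m).im = 0) ∧ ∀ k m, 0 < (a k m).re} := by
    intro p hp
    have hre : ∀ k m, (assemble o T 1 p k m).re = √(reSq o T p k m) := by
      intro k m; simp [assemble]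
    have him : ∀ k m, (assemble o T 1 p k m).im = extendZero T p.2 k m := by
      intro k m; simp [assemble]
    have hsq : ∀ k m, Complex.normSq (assemble o T 1 p k m) = completion o p.1 k m := by
      intro k m
      rw [Complex.normSq_apply, hre, him, Real.mul_self_sqrt (hp k m).le, reSq]
      ring
    refine ⟨assemble o T 1 p, ⟨⟨fun k => ?_, fun m => ?_⟩, fun k m h => ?_, fun k m => ?_⟩, ?_⟩
    · simp only [hsq, sum_completion_row]
    · simp only [hsq, sum_completion_column]
    · simp [him, extendZero, h]
    · rw [hre]; exact Real.sqrt_pos.2 (hp k m)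
    · refine Prod.ext ?_ ?_
      · funext k m
        simp [parameters, hsq, completion, k.2, m.2]
      · funext t
        simp [parameters, him, extendZero]
  calc (((Fintype.card ι - 1) ^ 2 + T.card : ℕ) : ENNReal)
      = dimH U := by
        rw [Real.dimH_of_nonempty_interior (s := U) ⟨_, by rwa [hU.interior_eq]⟩,
          finrank_parameters]
    _ ≤ _ := dimH_mono hsub
    _ ≤ _ := dimH_image_le_of_contDiffAt fun _ _ => (contDiff_parameters o T).contDiffAt

end Bistochastic

/-! ### Dimension of the torus of phases -/

section Circle

/-- The real dimension of a torus is the number of its circles. -/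
theorem dimH_univ_pi_circle (ι : Type*) [Fintype ι] :
    dimH (Set.univ : Set (ι → Circle)) = (Fintype.card ι : ENNReal) := by
  have hiso : Isometry fun (u : ι → Circle) (i : ι) => (u i : ℂ) :=
    Isometry.piMap (fun _ => ((↑) : Circle → ℂ)) fun _ => isometry_subtype_coe
  rw [← hiso.dimH_image, Set.image_univ]
  refine le_antisymm ?_ ?_
  · have hf : ContDiff ℝ 1 fun (θ : ι → ℝ) (i : ι) => Complex.exp (θ i * Complex.I) := by
      refine contDiff_pi.2 fun i => ContDiff.cexp (ContDiff.mul ?_ contDiff_const)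
      exact Complex.ofRealCLM.contDiff.comp (contDiff_apply ℝ ℝ i)
    have hrange : (Set.range fun (u : ι → Circle) (i : ι) => (u i : ℂ)) ⊆
        Set.range fun (θ : ι → ℝ) (i : ι) => Complex.exp (θ i * Complex.I) := by
      rintro _ ⟨u, rfl⟩
      refine ⟨fun i => Complex.arg (u i), funext fun i => ?_⟩
      have h := Complex.norm_mul_exp_arg_mul_I (u i : ℂ)
      rwa [Circle.norm_coe, Complex.ofReal_one, one_mul] at h
    refine (dimH_mono hrange).trans (hf.dimH_range_le.trans ?_)
    simp
  · have hf : ContDiff ℝ 1 fun (z : ι → ℂ) (i : ι) => (z i).im :=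
      contDiff_pi.2 fun i => Complex.imCLM.contDiff.comp (contDiff_apply ℝ ℂ i)
    -- Lower bound: the imaginary parts of points of the torus fill the unit ball, lifted by the
    -- nonnegative root `√(1 - y²)`.
    have hsub : Metric.ball (0 : ι → ℝ) 1 ⊆ (fun (z : ι → ℂ) (i : ι) => (z i).im) ''
        Set.range fun (u : ι → Circle) (i : ι) => (u i : ℂ) := by
      intro y hy
      have hy' : ∀ i, y i ^ 2 ≤ 1 := fun i => by
        have := (norm_le_pi_norm y i).trans (mem_ball_zero_iff.1 hy).le
        rwa [Real.norm_eq_abs, ← sq_le_one_iff_abs_le_one] at this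
      have hmem : ∀ i, (⟨√(1 - y i ^ 2), y i⟩ : ℂ) ∈ Submonoid.unitSphere ℂ := fun i => by
        refine mem_sphere_zero_iff_norm.2 ?_
        rw [← pow_eq_one_iff_of_nonneg (norm_nonneg _) two_ne_zero,
          ← Complex.normSq_eq_norm_sq, Complex.normSq_apply]
        simp only
        rw [Real.mul_self_sqrt (sub_nonneg.2 (hy' i))]
        ring
      exact ⟨_, ⟨fun i => ⟨_, hmem i⟩, rfl⟩, rfl⟩
    calc (Fintype.card ι : ENNReal) = dimH (Metric.ball (0 : ι → ℝ) 1) :=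
          (Real.dimH_ball_pi 0 one_pos).symm
      _ ≤ _ := dimH_mono hsub
      _ ≤ _ := dimH_image_le_of_contDiffAt fun _ _ => hf.contDiffAt

end Circle

variable {d : ℕ} [NeZero d]

/-! ### Fourier analysis on `ZMod d` -/

section Fourier

theorem omega_zpow (z : ℤ) : omega d ^ z = ZMod.stdAddChar (z : ZMod d) := by
  rw [ZMod.stdAddChar_coe, omega, ← Complex.exp_int_mul]
  congr 1
  ring

theorem omega_pow_val (k j : ZMod d) : omega d ^ (k.val * j.val) = ZMod.stdAddChar (k * j) := by
  rw [← zpow_natCast, omega_zpow]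
  simp

theorem omega_zpow_neg_val (i l : ZMod d) :
    omega d ^ (-((i.val * l.val : ℕ) : ℤ)) = ZMod.stdAddChar (-(i * l)) := by
  rw [omega_zpow]
  simp

theorem sum_stdAddChar_mul (b : ZMod d) :
    ∑ k : ZMod d, ZMod.stdAddChar (k * b) = if b = 0 then (d : ℂ) else 0 := by
  rw [AddChar.sum_mulShift b (ZMod.isPrimitive_stdAddChar d), ZMod.card]
  simp

/-- The Fourier transform of a power spectrum is an autocorrelation. -/
theorem sum_stdAddChar_normSq (f : ZMod d → ℂ) (l : ZMod d) :
    ∑ k, ZMod.stdAddChar (-(k * l)) *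
      (Complex.normSq (∑ j, ZMod.stdAddChar (k * j) * f j) : ℂ) =
        d * ∑ j, f (j + l) * star (f j) := by
  have hexp : ∀ k, ZMod.stdAddChar (-(k * l)) *
      (Complex.normSq (∑ j, ZMod.stdAddChar (k * j) * f j) : ℂ) =
      ∑ j', ∑ j, ZMod.stdAddChar (k * (j - (j' + l))) * (f j * star (f j')) := by
    intro k
    rw [← Complex.mul_conj, map_sum, Finset.sum_mul_sum, Finset.sum_comm, Finset.mul_sum]
    refine Finset.sum_congr rfl fun j' _ => ?_
    rw [Finset.mul_sum]
    refine Finset.sum_congr rfl fun j _ => ?_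
    rw [map_mul (starRingEnd ℂ), ← AddChar.map_neg_eq_conj]
    have h : k * (j - (j' + l)) = -(k * l) + k * j + -(k * j') := by ring
    rw [h, AddChar.map_add_eq_mul, AddChar.map_add_eq_mul]
    simp only [starRingEnd_apply]
    ring
  simp_rw [hexp]
  rw [Finset.sum_comm, Finset.mul_sum]
  refine Finset.sum_congr rfl fun j' _ => ?_
  rw [Finset.sum_comm]
  -- Orthogonality of characters in `k` keeps only the terms with `j = j' + l`.
  simp_rw [← Finset.sum_mul, sum_stdAddChar_mul, sub_eq_zero, ite_mul, zero_mul]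
  simp

/-- A function is constantly `1` if and only if its Fourier transform is `d` at zero and vanishes
elsewhere. -/
theorem eq_one_iff_sum_stdAddChar (r : ZMod d → ℂ) :
    (∀ k, r k = 1) ↔
      ∀ l, ∑ k, ZMod.stdAddChar (-(k * l)) * r k = if l = 0 then (d : ℂ) else 0 := by
  have hone : ∀ l : ZMod d, ∑ k, ZMod.stdAddChar (-(k * l)) * (1 : ℂ) =
      if l = 0 then (d : ℂ) else 0 := by
    intro l
    have := sum_stdAddChar_mul (-l)
    simpa [mul_neg] using this
  constructor
  · intro h l
    simpa only [h] using hone l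
  · intro h
    have : r = fun _ => 1 := by
      refine (ZMod.dft (N := d) (E := ℂ)).injective (funext fun l => ?_)
      rw [ZMod.dft_apply, ZMod.dft_apply]
      simp only [smul_eq_mul]
      rw [h, hone]
    exact fun k => congrFun this k

end Fourier

/-! ### Transition amplitudes and the channel conditions -/

/-- The transition amplitude `⟨m| K_{m - k} |k⟩`. -/
def amplitude (α : Matrix (ZMod d) (ZMod d) ℂ) (k m : ZMod d) : ℂ :=
  ∑ j, ZMod.stdAddChar (k * j) * α (m - k) j

theorem amplitude_eq_dft (α : Matrix (ZMod d) (ZMod d) ℂ) (k m : ZMod d) :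
    amplitude α k m = ZMod.dft (α (m - k)) (-k) := by
  rw [amplitude, ZMod.dft_apply]
  refine Finset.sum_congr rfl fun j _ => ?_
  rw [smul_eq_mul]
  congr 2
  ring

theorem amplitude_injective : Function.Injective (amplitude (d := d)) := by
  intro α β h
  funext i
  refine (ZMod.dft (N := d) (E := ℂ)).injective (funext fun k => ?_)
  have := congrFun (congrFun h (-k)) (i + -k)
  simpa [amplitude_eq_dft] using this

theorem amplitude_surjective : Function.Surjective (amplitude (d := d)) := by
  intro a
  refine ⟨Matrix.of fun i => (ZMod.dft (N := d) (E := ℂ)).symm fun k => a (-k) (-k + i), ?_⟩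
  funext k m
  rw [amplitude_eq_dft]
  change ZMod.dft ((ZMod.dft (N := d) (E := ℂ)).symm _) (-k) = _
  rw [LinearEquiv.apply_symm_apply]
  simp

/-- The transition amplitudes as a real-linear function of the coefficients. -/
def amplitudeLinear (d : ℕ) [NeZero d] :
    Matrix (ZMod d) (ZMod d) ℂ →ₗ[ℝ] (ZMod d → ZMod d → ℂ) where
  toFun := amplitude
  map_add' α β := by
    funext k m
    simp [amplitude, mul_add, Finset.sum_add_distrib]
  map_smul' c α := by
    funext k m
    simp only [amplitude, Matrix.smul_apply, RingHom.id_apply, Pi.smul_apply, Finset.smul_sum,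
      mul_smul_comm]

theorem kraus_apply (α : Matrix (ZMod d) (ZMod d) ℂ) (i m k : ZMod d) :
    kraus α i m k = if m - k = i then amplitude α k m else 0 := by
  have hw : ∀ j, weyl d i j m k = if m - k = i then ZMod.stdAddChar (k * j) else 0 := by
    intro j
    simp only [weyl, Matrix.sum_apply, Matrix.smul_apply, Matrix.single_apply, omega_pow_val,
      smul_eq_mul, mul_ite, mul_one, mul_zero]
    rw [Finset.sum_eq_single k (fun b _ hb => by simp [hb]) (by simp)]
    simp only [and_true, sub_eq_iff_eq_add', eq_comm (a := k + i)]
  simp only [kraus, Matrix.sum_apply, Matrix.smul_apply, hw, smul_eq_mul, mul_ite, mul_zero]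
  split_ifs with h
  · simp [amplitude, h, mul_comm]
  · simp

/-- The products `a_{km} a_{ln}^*` with `m - k = n - l`. -/
def gram (a : ZMod d → ZMod d → ℂ) (k m l n : ZMod d) : ℂ :=
  if m - k = n - l then a k m * star (a l n) else 0

/-- Entries `(m, k)` and `(n, l)` of the same `K_i` are both nonzero only if `i = m - k = n - l`, so
the sum over `i` has at most one term. -/
theorem krausMap_apply (α ρ : Matrix (ZMod d) (ZMod d) ℂ) (m n : ZMod d) :
    krausMap α ρ m n = ∑ k, ∑ l, gram (amplitude α) k m l n * ρ k l := by
  simp only [krausMap, LinearMap.coe_mk, AddHom.coe_mk, Matrix.sum_apply, Matrix.mul_apply,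
    Matrix.conjTranspose_apply, kraus_apply, Finset.sum_mul]
  rw [Finset.sum_comm, Finset.sum_congr rfl fun _ _ => Finset.sum_comm, Finset.sum_comm]
  refine Finset.sum_congr rfl fun k _ => Finset.sum_congr rfl fun l _ => ?_
  rw [Finset.sum_eq_single (m - k) (fun i _ hi => by simp [hi.symm]) (by simp), gram]
  by_cases h : m - k = n - l
  · simp [h]
    ring
  · simp [h, Ne.symm h]

/-- The matrix elements of a linear map on matrices. -/
def matrixElements (d : ℕ) :
    (Matrix (ZMod d) (ZMod d) ℂ →ₗ[ℂ] Matrix (ZMod d) (ZMod d) ℂ) →ₗ[ℝ]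
      (ZMod d → ZMod d → ZMod d → ZMod d → ℂ) where
  toFun E k m l n := E (Matrix.single k l 1) m n
  map_add' _ _ := rfl
  map_smul' _ _ := rfl

theorem matrixElements_injective : Function.Injective (matrixElements d) := by
  intro E E' h
  refine Matrix.ext_linearMap _ fun k l => LinearMap.ext_ring ?_
  ext m n
  exact congrFun (congrFun (congrFun (congrFun h k) m) l) n

theorem matrixElements_krausMap (α : Matrix (ZMod d) (ZMod d) ℂ) :
    matrixElements d (krausMap α) = gram (amplitude α) := by
  funext k m l n
  change krausMap α (Matrix.single k l 1) m n = _
  rw [krausMap_apply, Finset.sum_eq_single k (fun k' _ hk => by simp [Matrix.single, hk.symm])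
    (by simp), Finset.sum_eq_single l (fun l' _ hl => by simp [Matrix.single, hl.symm]) (by simp)]
  simp

/-- The trace sets `m = n`, and then `m - k = n - l` forces `k = l`: the off-diagonal conditions
hold automatically. Unitality is the same with the roles exchanged. -/
theorem isTracePreserving_krausMap_iff (α : Matrix (ZMod d) (ZMod d) ℂ) :
    IsTracePreserving (krausMap α) ↔
      ∀ k, ∑ m, Complex.normSq (amplitude α k m) = 1 := by
  have htr : ∀ ρ, (krausMap α ρ).trace =
      ∑ k, ((∑ m, Complex.normSq (amplitude α k m) : ℝ) : ℂ) * ρ k k := by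
    intro ρ
    simp only [Matrix.trace, Matrix.diag_apply, krausMap_apply]
    rw [Finset.sum_comm]
    refine Finset.sum_congr rfl fun k _ => ?_
    rw [Complex.ofReal_sum, Finset.sum_mul]
    refine Finset.sum_congr rfl fun m _ => ?_
    rw [Finset.sum_eq_single k (fun l _ hl => by simp [gram, hl.symm]) (by simp)]
    simp [gram, ← Complex.mul_conj]
  constructor
  · intro h k
    have := h (Matrix.single k k 1)
    rw [htr, Finset.sum_eq_single k (fun l _ hl => by simp [Matrix.single, hl.symm]) (by simp),
      Matrix.trace_single_eq_same, Matrix.single_apply_same, mul_one] at this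
    exact_mod_cast this
  · intro h ρ
    rw [htr]
    simp [h, Matrix.trace]

theorem isUnital_krausMap_iff (α : Matrix (ZMod d) (ZMod d) ℂ) :
    IsUnital (krausMap α) ↔ ∀ m, ∑ k, Complex.normSq (amplitude α k m) = 1 := by
  have hone : ∀ m n, krausMap α 1 m n =
      if m = n then ((∑ k, Complex.normSq (amplitude α k m) : ℝ) : ℂ) else 0 := by
    intro m n
    rw [krausMap_apply]
    have : ∀ k, ∑ l, gram (amplitude α) k m l n * (1 : Matrix (ZMod d) (ZMod d) ℂ) k l =
        if m = n then (Complex.normSq (amplitude α k m) : ℂ) else 0 := by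
      intro k
      rw [Finset.sum_eq_single k (fun l _ hl => by simp [hl.symm]) (by simp)]
      by_cases h : m = n
      · subst h
        simp [gram, ← Complex.mul_conj]
      · simp [gram, h]
    simp_rw [this]
    split_ifs <;> simp
  constructor
  · intro h m
    have := hone m m
    rw [h, Matrix.one_apply_eq, if_pos rfl] at this
    exact_mod_cast this.symm
  · intro h
    ext m n
    rw [hone, h, Matrix.one_apply]
    simp

/-- The `l`-th Fourier coefficients of the row and column sums of `|a|²` are `d` times the left-hand
sides of the equations. The column index `m = k + i` produces the factor `ω^{-il}`. At `l = 0` both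
families give the normalisation. -/
theorem mem_coefficients_iff (α : Matrix (ZMod d) (ZMod d) ℂ) :
    α ∈ coefficients d ↔ amplitude α ∈ bistochasticModuli (ZMod d) := by
  have hd : (d : ℂ) ≠ 0 := Nat.cast_ne_zero.2 (NeZero.ne d)
  have hcorr : ∀ i l, ∑ k, ZMod.stdAddChar (-(k * l)) *
      (Complex.normSq (amplitude α k (k + i)) : ℂ) =
      d * ∑ j, α i (j + l) * star (α i j) := by
    intro i l
    rw [← sum_stdAddChar_normSq]
    simp [amplitude]
  have hrow : ∀ l, ∑ k, ZMod.stdAddChar (-(k * l)) *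
      ((∑ m, Complex.normSq (amplitude α k m) : ℝ) : ℂ) =
      d * ∑ i, ∑ j, α i (j + l) * star (α i j) := by
    intro l
    rw [Finset.mul_sum]
    simp_rw [← hcorr]
    rw [Finset.sum_comm]
    refine Finset.sum_congr rfl fun k _ => ?_
    rw [← Finset.mul_sum, Complex.ofReal_sum]
    congr 1
    exact (Equiv.sum_comp (Equiv.addLeft k)
      fun m => (Complex.normSq (amplitude α k m) : ℂ)).symm
  have hcol : ∀ l, ∑ m, ZMod.stdAddChar (-(m * l)) *
      ((∑ k, Complex.normSq (amplitude α k m) : ℝ) : ℂ) =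
      d * ∑ i, ∑ j, α i (j + l) * star (α i j) * omega d ^ (-((i.val * l.val : ℕ) : ℤ)) := by
    intro l
    simp_rw [omega_zpow_neg_val, ← Finset.sum_mul]
    rw [Finset.mul_sum]
    simp_rw [← mul_assoc, ← hcorr]
    simp_rw [Complex.ofReal_sum, Finset.mul_sum]
    simp_rw [Finset.sum_mul]
    rw [Finset.sum_comm, Finset.sum_comm (s := Finset.univ (α := ZMod d)) (t := Finset.univ)
      (f := fun i k => _ * _ * _)]
    refine Finset.sum_congr rfl fun k _ => ?_
    rw [← Equiv.sum_comp (Equiv.addLeft k)]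
    refine Finset.sum_congr rfl fun i _ => ?_
    simp only [Equiv.coe_addLeft]
    rw [show -((k + i) * l) = -(k * l) + -(i * l) by ring, AddChar.map_add_eq_mul]
    ring
  have hscale : ∀ x (l : ZMod d), (d : ℂ) * x = (if l = 0 then (d : ℂ) else 0) ↔
      x = if l = 0 then 1 else 0 := by
    intro x l
    split_ifs <;> simp [hd]
  have hR : (∀ k, ∑ m, Complex.normSq (amplitude α k m) = 1) ↔
      ∀ l, ∑ i, ∑ j, α i (j + l) * star (α i j) = if l = 0 then 1 else 0 := by
    have h := eq_one_iff_sum_stdAddChar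
      fun k => ((∑ m, Complex.normSq (amplitude α k m) : ℝ) : ℂ)
    simpa only [hrow, hscale, Complex.ofReal_eq_one] using h
  have hC : (∀ m, ∑ k, Complex.normSq (amplitude α k m) = 1) ↔
      ∀ l, ∑ i, ∑ j, α i (j + l) * star (α i j) * omega d ^ (-((i.val * l.val : ℕ) : ℤ)) =
        if l = 0 then 1 else 0 := by
    have h := eq_one_iff_sum_stdAddChar
      fun m => ((∑ k, Complex.normSq (amplitude α k m) : ℝ) : ℂ)
    simpa only [hcol, hscale, Complex.ofReal_eq_one] using h
  constructor
  · rintro ⟨h0, h1, h2⟩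
    refine ⟨hR.2 fun l => ?_, hC.2 fun l => ?_⟩ <;> by_cases hl : l = 0
    · simpa only [hl, add_zero, if_pos] using h0
    · rw [if_neg hl, h1 l hl]
    · simpa only [hl, add_zero, ZMod.val_zero, mul_zero, Nat.cast_zero, neg_zero, zpow_zero,
        mul_one, if_pos] using h0
    · rw [if_neg hl, h2 l hl]
  · rintro ⟨hr, hc⟩
    refine ⟨?_, fun l hl => ?_, fun l hl => ?_⟩
    · simpa only [add_zero, if_pos] using hR.1 hr 0
    · rw [hR.1 hr l, if_neg hl]
    · rw [hC.1 hc l, if_neg hl]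

/-! ### Phase ambiguity of the coefficients -/

section Phases

theorem exists_circle_mul_eq_norm (z : ℂ) : ∃ u : Circle, (u : ℂ) * z = ‖z‖ := by
  refine ⟨Circle.exp (-z.arg), ?_⟩
  nth_rewrite 2 [← Complex.norm_mul_exp_arg_mul_I z]
  rw [Circle.coe_exp, mul_left_comm, ← Complex.exp_add]
  simp

/-- Two vectors that span the same rank one projection differ by a phase. -/
theorem exists_circle_of_mul_star_eq {κ : Type*} {v w : κ → ℂ}
    (h : ∀ k l, v k * star (v l) = w k * star (w l)) :
    ∃ u : Circle, ∀ k, w k = u * v k := by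
  by_cases hv : ∀ k, v k = 0
  · refine ⟨1, fun k => ?_⟩
    have := h k k
    rw [hv k, zero_mul, eq_comm, mul_eq_zero, star_eq_zero, or_self] at this
    rw [this, hv k, mul_zero]
  · push Not at hv
    obtain ⟨l, hl⟩ := hv
    have hnorm : ‖w l‖ = ‖v l‖ := by
      have := congrArg norm (h l l)
      rw [norm_mul, norm_mul, norm_star, norm_star] at this
      exact ((mul_self_inj (norm_nonneg _) (norm_nonneg _)).1 this).symm
    have hw : w l ≠ 0 := by
      rw [← norm_ne_zero_iff, hnorm, norm_ne_zero_iff]; exact hl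
    -- The phase is read off by solving `v_k v_l^* = w_k w_l^*` for `w_k`.
    have hmem : star (v l) / star (w l) ∈ Submonoid.unitSphere ℂ := by
      refine mem_sphere_zero_iff_norm.2 ?_
      rw [norm_div, norm_star, norm_star, hnorm, div_self (norm_ne_zero_iff.2 hl)]
    refine ⟨⟨_, hmem⟩, fun k => ?_⟩
    change w k = star (v l) / star (w l) * v k
    rw [div_mul_eq_mul_div, eq_div_iff (star_ne_zero.2 hw), ← h k l, mul_comm]

theorem circle_mul_star (u : Circle) : (u : ℂ) * star (u : ℂ) = 1 := by
  change (u : ℂ) * starRingEnd ℂ u = 1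
  rw [Complex.mul_conj, Circle.normSq_coe, Complex.ofReal_one]

theorem gram_phase {n : ℕ} (u : ZMod n → Circle) (a : ZMod n → ZMod n → ℂ) :
    gram (fun k m => u (m - k) * a k m) = gram a := by
  funext k m l n
  unfold gram
  split_ifs with h
  · dsimp only
    rw [h, star_mul', mul_mul_mul_comm, circle_mul_star, one_mul]
  · rfl

/-- For fixed `i`, the products form the rank one matrix of the vector `k ↦ a_{k,k+i}`, which fixes
this vector up to its own phase `u_i`. -/
theorem gram_eq_gram_iff (a b : ZMod d → ZMod d → ℂ) :
    gram a = gram b ↔ ∃ u : ZMod d → Circle, ∀ k m, b k m = u (m - k) * a k m := by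
  constructor
  · intro h
    have : ∀ i, ∃ u : Circle, ∀ k, b k (k + i) = u * a k (k + i) := by
      intro i
      refine exists_circle_of_mul_star_eq (v := fun k => a k (k + i)) fun k l => ?_
      have := congrFun (congrFun (congrFun (congrFun h k) (k + i)) l) (l + i)
      simpa [gram] using this
    choose u hu using this
    refine ⟨u, fun k m => ?_⟩
    have := hu (m - k) k
    rwa [add_sub_cancel] at this
  · rintro ⟨u, hu⟩
    rw [← gram_phase u a]
    congr 1
    funext k m
    exact (hu k m).symm

theorem krausMap_eq_krausMap_iff (α β : Matrix (ZMod d) (ZMod d) ℂ) :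
    krausMap α = krausMap β ↔ ∃ u : ZMod d → Circle, ∀ i j, β i j = (u i : ℂ) * α i j := by
  rw [← matrixElements_injective.eq_iff, matrixElements_krausMap, matrixElements_krausMap,
    gram_eq_gram_iff]
  refine exists_congr fun u => ?_
  have hu : amplitude (Matrix.of fun i j => (u i : ℂ) * α i j) =
      fun k m => u (m - k) * amplitude α k m := by
    funext k m
    simp only [amplitude, Finset.mul_sum, Matrix.of_apply]
    exact Finset.sum_congr rfl fun j _ => mul_left_comm _ _ _
  constructor
  · intro h i j
    have : β = Matrix.of fun i j => (u i : ℂ) * α i j := by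
      refine amplitude_injective ?_
      rw [hu]
      funext k m
      exact h k m
    rw [this, Matrix.of_apply]
  · intro h k m
    have : β = Matrix.of fun i j => (u i : ℂ) * α i j := by
      ext i j
      exact h i j
    rw [this, hu]

end Phases

/-! ### Dimensions of the coefficient set and of the channels -/

theorem channels_eq_image : channels d = krausMap '' coefficients d := by
  ext E
  constructor
  · rintro ⟨⟨α, rfl⟩, htp, hun⟩
    exact ⟨α, (mem_coefficients_iff α).2 ⟨(isTracePreserving_krausMap_iff α).1 htp,
      (isUnital_krausMap_iff α).1 hun⟩, rfl⟩
  · rintro ⟨α, hα, rfl⟩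
    have h := (mem_coefficients_iff α).1 hα
    exact ⟨⟨α, rfl⟩, (isTracePreserving_krausMap_iff α).2 h.1, (isUnital_krausMap_iff α).2 h.2⟩

theorem amplitude_image_coefficients :
    amplitude '' coefficients d = bistochasticModuli (ZMod d) := by
  ext a
  constructor
  · rintro ⟨α, hα, rfl⟩
    exact (mem_coefficients_iff α).1 hα
  · intro ha
    obtain ⟨α, rfl⟩ := amplitude_surjective a
    exact ⟨α, (mem_coefficients_iff α).2 ha, rfl⟩

theorem matrixElements_image_channels :
    matrixElements d '' channels d = gram '' bistochasticModuli (ZMod d) := by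
  rw [channels_eq_image, ← amplitude_image_coefficients, ← Set.image_comp, ← Set.image_comp]
  exact Set.image_congr fun α _ => matrixElements_krausMap α

theorem realDim_coefficients :
    realDim (coefficients d) = ((d - 1) ^ 2 + d ^ 2 : ℕ) := by
  rw [realDim_eq_dimH_image (amplitudeLinear d) amplitude_injective]
  change dimH (amplitude '' coefficients d) = _
  rw [amplitude_image_coefficients]
  have hcard : (Fintype.card (ZMod d) - 1) ^ 2 +
      (Finset.univ : Finset (ZMod d × ZMod d)).card = (d - 1) ^ 2 + d ^ 2 := by
    simp [sq]
  refine le_antisymm ?_ ?_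
  · rw [← hcard]
    refine (dimH_mono ?_).trans (dimH_bistochasticModuli_le 0 Finset.univ)
    exact fun a ha => ⟨ha, fun k m h => absurd (Finset.mem_univ _) h⟩
  · rw [← hcard]
    exact (le_dimH_bistochasticModuli 0 Finset.univ).trans (dimH_mono fun a ha => ha.1)

theorem contDiff_gram : ContDiff ℝ 1 (gram (d := d)) := by
  have hconj : ContDiff ℝ 1 (star : ℂ → ℂ) := Complex.conjCLE.contDiff
  have hcoord : ∀ k m, ContDiff ℝ 1 fun a : ZMod d → ZMod d → ℂ => a k m := fun k m => by
    fun_prop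
  refine contDiff_pi.2 fun k => contDiff_pi.2 fun m => contDiff_pi.2 fun l =>
    contDiff_pi.2 fun n => ?_
  unfold gram
  split_ifs
  · exact (hcoord k m).mul (hconj.comp (hcoord l n))
  · exact contDiff_const

/-- The amplitudes, normalised by `a_{0m} > 0`, recovered from their products. -/
def amplitudesOfGram (c : ZMod d → ZMod d → ZMod d → ZMod d → ℂ) (k m : ZMod d) : ℂ :=
  c k m 0 (m - k) * ((√(c 0 (m - k) 0 (m - k)).re)⁻¹ : ℝ)

theorem contDiffAt_amplitudesOfGram {c : ZMod d → ZMod d → ZMod d → ZMod d → ℂ}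
    (hc : ∀ i, 0 < (c 0 i 0 i).re) : ContDiffAt ℝ 1 amplitudesOfGram c := by
  have hcoord : ∀ k m l n,
      ContDiff ℝ 1 fun c : ZMod d → ZMod d → ZMod d → ZMod d → ℂ => c k m l n := by
    intro k m l n
    fun_prop
  refine contDiffAt_pi.2 fun k => contDiffAt_pi.2 fun m => ?_
  refine (hcoord k m 0 (m - k)).contDiffAt.mul ?_
  refine Complex.ofRealCLM.contDiff.contDiffAt.comp c ?_
  refine ContDiffAt.inv ?_ (Real.sqrt_pos.2 (hc _)).ne'
  exact (Complex.reCLM.contDiff.comp (hcoord 0 (m - k) 0 (m - k))).contDiffAt.sqrt (hc _).ne'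

theorem gram_diagonal {n : ℕ} (a : ZMod n → ZMod n → ℂ) (k m : ZMod n) :
    gram a k m k m = (Complex.normSq (a k m) : ℂ) := by
  simp [gram, ← Complex.mul_conj]

/-- The entry `(0, m - k)` lies on the same diagonal as `(k, m)`, so `a_{km} a_{0,m-k}` is available
and can be divided by the positive `a_{0,m-k}`. -/
theorem amplitudesOfGram_gram {n : ℕ} {a : ZMod n → ZMod n → ℂ}
    (him : ∀ m, (a 0 m).im = 0) (hre : ∀ m, 0 < (a 0 m).re) :
    amplitudesOfGram (gram a) = a := by
  funext k m
  have ha : a 0 (m - k) = ((a 0 (m - k)).re : ℂ) := Complex.ext rfl (by simp [him])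
  have hne : ((a 0 (m - k)).re : ℂ) ≠ 0 := Complex.ofReal_ne_zero.2 (hre _).ne'
  rw [amplitudesOfGram, gram_diagonal, Complex.ofReal_re, Complex.normSq_apply, him, mul_zero,
    add_zero, Real.sqrt_mul_self (hre _).le, gram, if_pos (by simp), ha]
  simp only [RCLike.star_def, Complex.conj_ofReal, Complex.ofReal_re, Complex.ofReal_inv]
  rw [mul_assoc, mul_inv_cancel₀ hne, mul_one]

/-- Diagonal `m` meets row `0` only at `(0, m)`, so its phase can be chosen independently to make
that entry real. -/
theorem exists_gram_eq_im_eq_zero {a : ZMod d → ZMod d → ℂ}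
    (ha : a ∈ bistochasticModuli (ZMod d)) :
    ∃ b ∈ bistochasticModuli (ZMod d), (∀ m, (b 0 m).im = 0) ∧ gram b = gram a := by
  choose u hu using fun m => exists_circle_mul_eq_norm (a 0 m)
  refine ⟨fun k m => u (m - k) * a k m, ?_, fun m => ?_, gram_phase u a⟩
  · simpa only [bistochasticModuli, Set.mem_ofPred_eq, map_mul, Circle.normSq_coe, one_mul] using ha
  · simp only [sub_zero, hu, Complex.ofReal_im]

theorem realDim_channels :
    realDim (channels d) = ((d - 1) ^ 2 + (d - 1) * d : ℕ) := by
  rw [realDim_eq_dimH_image (matrixElements d) matrixElements_injective,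
    matrixElements_image_channels]
  -- Imaginary parts remain free outside row `0`, at `(d - 1) d` positions.
  let T : Finset (ZMod d × ZMod d) := ({0}ᶜ : Finset (ZMod d)) ×ˢ Finset.univ
  have hT : ∀ k m, (k, m) ∉ T ↔ k = 0 := fun k m => by simp [T]
  have hcard : (Fintype.card (ZMod d) - 1) ^ 2 + T.card = (d - 1) ^ 2 + (d - 1) * d := by
    simp [T, Finset.card_compl]
  rw [← hcard]
  refine le_antisymm ?_ ?_
  · refine le_trans ?_ (dimH_bistochasticModuli_le 0 T)
    refine (dimH_mono ?_).trans
      (dimH_image_le_of_contDiffAt (f := gram) fun _ _ => contDiff_gram.contDiffAt)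
    rintro _ ⟨a, ha, rfl⟩
    obtain ⟨b, hb, him, hab⟩ := exists_gram_eq_im_eq_zero ha
    refine ⟨b, ⟨hb, fun k m h => ?_⟩, hab⟩
    rw [(hT k m).1 h]
    exact him m
  · refine (le_dimH_bistochasticModuli 0 T).trans ?_
    set P := {a ∈ bistochasticModuli (ZMod d) |
      (∀ k m, (k, m) ∉ T → (a k m).im = 0) ∧ ∀ k m, 0 < (a k m).re}
    -- On the slice with real positive row `0`, `gram` has a `C¹` left inverse, so it loses no
    -- dimension.
    have hP : P = amplitudesOfGram '' (gram '' P) := by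
      rw [← Set.image_comp]
      refine (Set.image_id P).symm.trans (Set.image_congr fun a ha => ?_)
      exact (amplitudesOfGram_gram (fun m => ha.2.1 0 m ((hT 0 m).2 rfl)) (ha.2.2 0)).symm
    rw [hP]
    refine (dimH_image_le_of_contDiffAt ?_).trans
      (dimH_mono (Set.image_mono fun a ha => ha.1))
    rintro _ ⟨a, ha, rfl⟩
    refine contDiffAt_amplitudesOfGram fun i => ?_
    rw [gram_diagonal, Complex.ofReal_re, Complex.normSq_pos]
    intro h
    have := ha.2.2 0 i
    simp [h] at this

end HeisenbergWeyl

end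

theorem mainTheorem4 (d : ℕ) [NeZero d] :
    -- the dimension of the family of maps
    HeisenbergWeyl.realDim (HeisenbergWeyl.channels d) = ENNReal.ofReal (2 * (d : ℝ) ^ 2 - 3 * (d : ℝ) + 1) ∧
    -- the family is the coefficient set modulo the group of phases
    HeisenbergWeyl.channels d = HeisenbergWeyl.krausMap '' HeisenbergWeyl.coefficients d ∧
    (∀ α β : Matrix (ZMod d) (ZMod d) ℂ,
      HeisenbergWeyl.krausMap α = HeisenbergWeyl.krausMap β ↔
        ∃ u : ZMod d → Circle, ∀ i j, β i j = (u i : ℂ) * α i j) ∧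
    -- the parameter count: `2 d²` real parameters, `2 (d - 1) + 1` constraints, `d` phases
    Module.finrank ℝ (Matrix (ZMod d) (ZMod d) ℂ) = 2 * d ^ 2 ∧
    HeisenbergWeyl.realDim (HeisenbergWeyl.coefficients d) =
      ENNReal.ofReal (2 * (d : ℝ) ^ 2 - (2 * ((d : ℝ) - 1) + 1)) ∧
    dimH (Set.univ : Set (ZMod d → Circle)) = (d : ENNReal) := by
  have hd : 1 ≤ d := NeZero.one_le
  refine ⟨?_, HeisenbergWeyl.channels_eq_image, HeisenbergWeyl.krausMap_eq_krausMap_iff, ?_, ?_, ?_⟩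
  · rw [HeisenbergWeyl.realDim_channels, ← ENNReal.ofReal_natCast]
    congr 1
    push_cast [Nat.cast_sub hd]
    ring
  · rw [Module.finrank_matrix, ZMod.card, Complex.finrank_real_complex]
    ring
  · rw [HeisenbergWeyl.realDim_coefficients, ← ENNReal.ofReal_natCast]
    congr 1
    push_cast [Nat.cast_sub hd]
    ring
  · rw [HeisenbergWeyl.dimH_univ_pi_circle, ZMod.card]
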